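/- **Setting.** Let $(\bar M,\bar g)$ be a smooth semi-Riemannian manifold of constant index with Levi-Civita connection $\bar\nabla$, let $p,q$ be positive integers, and let $\bar J$ be a smooth $(1,1)$-tensor field on $\bar M$ with $\bar J^2=p\bar J+qI$ and $\bar g(X,\bar JY)=\bar g(\bar JX,Y)$ (a metallic structure), which is parallel: $\bar\nabla\bar J=0$. Let $\eta$ be a smooth vector field on $\bar M$, $\pi(X)=\bar g(X,\eta)$, and let $\bar D_XY=\bar\nabla_XY+\pi(Y)\bar JX$ be the associated quarter symmetric connection. Let $M$ be an immersed submanifold of $\bar M$ whose radical distribution $\mathrm{Rad}(TM)=TM\cap TM^\perp$ has constant rank $r>0$. Let $S(TM)$ be a screen distribution ($TM=\mathrm{Rad}(TM)\perp S(TM)$), $S(TM^\perp)$ a screen transversal bundle ($TM^\perp=\mathrm{Rad}(TM)\perp S(TM^\perp)$), and $\mathrm{ltr}(TM)$ a lightlike transversal bundle, i.e. an isotropic subbundle, complementary to $\mathrm{Rad}(TM)$ in the orthogonal complement of $S(TM)\perp S(TM^\perp)$, so that $T\bar M|_M=TM\oplus \mathrm{ltr}(TM)\oplus S(TM^\perp)$.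 Assume that $M$ is screen semi-invariant: there is a smooth distribution $B\subseteq S(TM)$ such that $S(TM)=B\oplus B^\perp$, where $B^\perp$ is the orthogonal complement of $B$ in $S(TM)$, and $\bar J(B)=B$, $\bar J(B^\perp)\subseteq S(TM^\perp)$, $\bar J(\mathrm{Rad}(TM))=\mathrm{Rad}(TM)$. For $U,V\in\Gamma(TM)$ let $\bar D_UV=D_UV+\bar h^l(U,V)+\bar h^s(U,V)$ be the decomposition of $\bar D_UV$ into its components in $TM$, $\mathrm{ltr}(TM)$ and $S(TM^\perp)$, and for $V\in\Gamma(S(TM))$ let $\bar h^*(U,V)$ be the component of $D_UV$ in $\mathrm{Rad}(TM)$ with respect to $TM=\mathrm{Rad}(TM)\oplus S(TM)$. **Theorem.** The distribution $B$ is integrable (that is, $[U,V]\in\Gamma(B)$ for all $U,V\in\Gamma(B)$) if and only if both of the following hold for all $U,V\in\Gamma(B)$: 1. $\bar h^s(U,\bar JV)=\bar h^s(V,\bar JU)$; 2. $\bar h^*(U,\bar JV)+p\,\bar h^*(V,U)=\bar h^*(V,\bar JU)+p\,\bar h^*(U,V)$. -/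

import Mathlib

open Bundle
open scoped Manifold ContDiff Topology

noncomputable section

namespace LightlikeGeometry

/-! ### Linear algebra of the decomposition
`V = (R ⊕ L) ⊥ S ⊥ W` with `T = R ⊥ S` and `T^⊥ = R ⊥ W` -/

section LinearAlgebra

variable {V : Type*} [AddCommGroup V] [Module ℝ V] [FiniteDimensional ℝ V]

/-- `T` is a subspace of the non-degenerate space `(V, b)`, `R = T ∩ T^⊥` is its radical, `S` a
complement of `R` in `T`, `W` a complement of `R` in `T^⊥`, and `L` an isotropic complement of `R`
in `(S ⊕ W)^⊥`. -/
structure IsLightlikeDecomposition (b : LinearMap.BilinForm ℝ V) (T S W L : Submodule ℝ V) :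
    Prop where
  disjoint_screen : Disjoint (T ⊓ b.orthogonal T) S
  sup_screen : (T ⊓ b.orthogonal T) ⊔ S = T
  disjoint_screenTrans : Disjoint (T ⊓ b.orthogonal T) W
  sup_screenTrans : (T ⊓ b.orthogonal T) ⊔ W = b.orthogonal T
  disjoint_ltr : Disjoint (T ⊓ b.orthogonal T) L
  sup_ltr : (T ⊓ b.orthogonal T) ⊔ L = b.orthogonal (S ⊔ W)
  isotropic_ltr : ∀ v ∈ L, ∀ w ∈ L, b v w = 0

namespace IsLightlikeDecomposition

variable {b : LinearMap.BilinForm ℝ V} {T S W L : Submodule ℝ V}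

theorem isCompl_screen_sup (h : IsLightlikeDecomposition b T S W L)
    (hs : b.IsSymm) (hb : b.Nondegenerate) :
    IsCompl (S ⊔ W) (b.orthogonal (S ⊔ W)) := by
  have hS : S ≤ T := h.sup_screen ▸ le_sup_right
  have hW : W ≤ b.orthogonal T := h.sup_screenTrans ▸ le_sup_right
  rw [LinearMap.BilinForm.isCompl_orthogonal_iff_disjoint hs.isRefl, Submodule.disjoint_def]
  intro x hx hx'
  obtain ⟨s, hs', w, hw, rfl⟩ := Submodule.mem_sup.1 hx
  rw [LinearMap.BilinForm.mem_orthogonal_iff] at hx'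
  have h1 : s ∈ b.orthogonal T := by
    rw [LinearMap.BilinForm.mem_orthogonal_iff]
    intro t ht
    rw [← h.sup_screen] at ht
    obtain ⟨r, hr, s', hs'', rfl⟩ := Submodule.mem_sup.1 ht
    have e1 : b r s = 0 := by
      rw [hs.eq]
      exact (LinearMap.BilinForm.mem_orthogonal_iff.1 hr.2) s (hS hs')
    have e2 : b s' (s + w) = 0 := hx' s' (Submodule.mem_sup_left hs'')
    have e3 : b s' w = 0 := (LinearMap.BilinForm.mem_orthogonal_iff.1 (hW hw)) s' (hS hs'')
    simp only [map_add, LinearMap.add_apply] at e2 ⊢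
    linarith
  have hs0 : s = 0 := (Submodule.disjoint_def.1 h.disjoint_screen) s ⟨hS hs', h1⟩ hs'
  have h2 : w ∈ b.orthogonal (b.orthogonal T) := by
    rw [LinearMap.BilinForm.mem_orthogonal_iff]
    intro t ht
    rw [← h.sup_screenTrans] at ht
    obtain ⟨r, hr, w', hw', rfl⟩ := Submodule.mem_sup.1 ht
    have e1 : b r w = 0 := (LinearMap.BilinForm.mem_orthogonal_iff.1 (hW hw)) r hr.1
    have e2 : b w' (s + w) = 0 := hx' w' (Submodule.mem_sup_right hw')
    rw [hs0, zero_add] at e2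
    simp only [map_add, LinearMap.add_apply]
    linarith
  rw [LinearMap.BilinForm.orthogonal_orthogonal hb hs.isRefl] at h2
  have hw0 : w = 0 := (Submodule.disjoint_def.1 h.disjoint_screenTrans) w ⟨h2, hW hw⟩ hw
  rw [hs0, hw0, add_zero]

/-- `V = T ⊕ (L ⊕ W)`. -/
theorem isCompl_tangent (h : IsLightlikeDecomposition b T S W L)
    (hs : b.IsSymm) (hb : b.Nondegenerate) : IsCompl T (L ⊔ W) := by
  have hP := h.isCompl_screen_sup hs hb
  have hW : W ≤ b.orthogonal T := h.sup_screenTrans ▸ le_sup_right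
  have hL : L ≤ b.orthogonal (S ⊔ W) := h.sup_ltr ▸ le_sup_right
  have hS : S ≤ T := h.sup_screen ▸ le_sup_right
  have htop : ∀ v : V, ∃ s ∈ S, ∃ w ∈ W, ∃ r ∈ T ⊓ b.orthogonal T, ∃ l ∈ L,
      v = (s + w) + (r + l) := by
    intro v
    have hv : v ∈ (S ⊔ W) ⊔ b.orthogonal (S ⊔ W) := by rw [hP.sup_eq_top]; trivial
    obtain ⟨a, ha, c, hc, rfl⟩ := Submodule.mem_sup.1 hv
    obtain ⟨s, hs', w, hw, rfl⟩ := Submodule.mem_sup.1 ha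
    rw [← h.sup_ltr] at hc
    obtain ⟨r, hr, l, hl, rfl⟩ := Submodule.mem_sup.1 hc
    exact ⟨s, hs', w, hw, r, hr, l, hl, rfl⟩
  refine ⟨?_, ?_⟩
  · rw [Submodule.disjoint_def]
    intro t ht ht'
    obtain ⟨l, hl, w, hw, rfl⟩ := Submodule.mem_sup.1 ht'
    have hl0 : l = 0 := by
      apply hb.1 l
      intro v
      obtain ⟨s, hs', w', hw', r, hr, l', hl', rfl⟩ := htop v
      have e1 : b l (s + w') = 0 := by
        rw [hs.eq]
        exact (LinearMap.BilinForm.mem_orthogonal_iff.1 (hL hl)) _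
          (Submodule.add_mem_sup hs' hw')
      have e2 : b l l' = 0 := h.isotropic_ltr l hl l' hl'
      have e3 : b (l + w) r = 0 := (LinearMap.BilinForm.mem_orthogonal_iff.1 hr.2) _ ht
      have e4 : b w r = 0 := by
        rw [hs.eq]
        exact (LinearMap.BilinForm.mem_orthogonal_iff.1 (hW hw)) _ hr.1
      simp only [map_add, LinearMap.add_apply] at e1 e3 ⊢
      linarith
    rw [hl0, zero_add] at ht ⊢
    exact (Submodule.disjoint_def.1 h.disjoint_screenTrans) w ⟨ht, hW hw⟩ hw
  · rw [codisjoint_iff, eq_top_iff]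
    intro v _
    obtain ⟨s, hs', w, hw, r, hr, l, hl, rfl⟩ := htop v
    have : (s + w) + (r + l) = (r + s) + (l + w) := by abel
    rw [this]
    exact Submodule.add_mem_sup (T.add_mem hr.1 (hS hs')) (Submodule.add_mem_sup hl hw)

/-- `V = W ⊕ (T ⊕ L)`. -/
theorem isCompl_screenTrans (h : IsLightlikeDecomposition b T S W L)
    (hs : b.IsSymm) (hb : b.Nondegenerate) : IsCompl W (T ⊔ L) := by
  have hT := h.isCompl_tangent hs hb
  have hL : L ≤ b.orthogonal (S ⊔ W) := h.sup_ltr ▸ le_sup_right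
  have hLW : Disjoint L W :=
    ((h.isCompl_screen_sup hs hb).disjoint.mono le_sup_right hL).symm
  refine ⟨(hLW.disjoint_sup_left_of_disjoint_sup_right hT.disjoint).symm, ?_⟩
  rw [codisjoint_iff, sup_comm, sup_assoc, hT.sup_eq_top]

/-- `V = R ⊕ (S ⊕ (L ⊕ W))`. -/
theorem isCompl_radical (h : IsLightlikeDecomposition b T S W L)
    (hs : b.IsSymm) (hb : b.Nondegenerate) :
    IsCompl (T ⊓ b.orthogonal T) (S ⊔ (L ⊔ W)) := by
  have hT := h.isCompl_tangent hs hb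
  refine ⟨h.disjoint_screen.disjoint_sup_right_of_disjoint_sup_left ?_, ?_⟩
  · rw [h.sup_screen]
    exact hT.disjoint
  · rw [codisjoint_iff, ← sup_assoc, h.sup_screen, hT.sup_eq_top]

end IsLightlikeDecomposition

end LinearAlgebra

/-! ### Ambient geometry -/

section Ambient

variable {E' : Type*} [NormedAddCommGroup E'] [NormedSpace ℝ E']
  {N : Type*} [TopologicalSpace N] [ChartedSpace E' N] [IsManifold 𝓘(ℝ, E') ∞ N]

variable (E' N) in
/-- A smooth semi-Riemannian metric of constant index on the manifold `N`. -/
structure SemiRiemannianMetric where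
  inner : ∀ x : N, TangentSpace 𝓘(ℝ, E') x →L[ℝ] TangentSpace 𝓘(ℝ, E') x →L[ℝ] ℝ
  symm : ∀ (x : N) (v w : TangentSpace 𝓘(ℝ, E') x), inner x v w = inner x w v
  nondegenerate : ∀ (x : N) (v : TangentSpace 𝓘(ℝ, E') x), (∀ w, inner x v w = 0) → v = 0
  index : ℕ
  sigNeg_eq : ∀ x : N, sigNeg (LinearMap.BilinMap.toQuadraticMap (inner x).toBilinForm) = index
  contMDiff : ContMDiff 𝓘(ℝ, E') (𝓘(ℝ, E').prod 𝓘(ℝ, E' →L[ℝ] E' →L[ℝ] ℝ)) ∞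
    (fun x ↦ TotalSpace.mk' (E' →L[ℝ] E' →L[ℝ] ℝ) x (inner x))

namespace SemiRiemannianMetric

/-- The scalar product on the tangent space at `x`, as a bilinear form. -/
def bilin (g : SemiRiemannianMetric E' N) (x : N) :
    LinearMap.BilinForm ℝ (TangentSpace 𝓘(ℝ, E') x) :=
  (g.inner x).toBilinForm

theorem bilin_isSymm (g : SemiRiemannianMetric E' N) (x : N) : (g.bilin x).IsSymm :=
  ⟨fun v w ↦ g.symm x v w⟩

theorem bilin_nondegenerate (g : SemiRiemannianMetric E' N) (x : N) :
    (g.bilin x).Nondegenerate := by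
  refine ⟨fun v hv ↦ g.nondegenerate x v hv, fun v hv ↦ g.nondegenerate x v fun w ↦ ?_⟩
  rw [g.symm]
  exact hv w

end SemiRiemannianMetric

/-- `∇` is the Levi-Civita connection of `g`: it is torsion-free and metric.
The value `∇ Y x v` is the covariant derivative of the vector field `Y` in direction `v` at `x`. -/
structure IsLeviCivita (g : SemiRiemannianMetric E' N)
    (nabla : CovariantDerivative 𝓘(ℝ, E') E' (fun x : N ↦ TangentSpace 𝓘(ℝ, E') x)) : Prop where
  torsion_free : ∀ (X Y : ∀ x : N, TangentSpace 𝓘(ℝ, E') x) (x : N),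
    MDiffAt (T% X) x → MDiffAt (T% Y) x →
      nabla Y x (X x) - nabla X x (Y x) = VectorField.mlieBracket 𝓘(ℝ, E') X Y x
  metric : ∀ (Y Z : ∀ x : N, TangentSpace 𝓘(ℝ, E') x) (x : N) (v : TangentSpace 𝓘(ℝ, E') x),
    MDiffAt (T% Y) x → MDiffAt (T% Z) x →
      mvfderiv 𝓘(ℝ, E') (fun y ↦ g.inner y (Y y) (Z y)) x v
        = g.inner x (nabla Y x v) (Z x) + g.inner x (Y x) (nabla Z x v)

/-- A metallic structure `J² = p J + q I`, with `p` and `q` positive integers, with respect to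
which the semi-Riemannian metric `g` is compatible: `g (U, J V) = g (J U, V)`. -/
structure MetallicStructure (g : SemiRiemannianMetric E' N) (p q : ℕ) where
  J : ∀ x : N, TangentSpace 𝓘(ℝ, E') x →L[ℝ] TangentSpace 𝓘(ℝ, E') x
  p_pos : 0 < p
  q_pos : 0 < q
  sq : ∀ (x : N) (v : TangentSpace 𝓘(ℝ, E') x), J x (J x v) = (p : ℝ) • J x v + (q : ℝ) • v
  compatible : ∀ (x : N) (u v : TangentSpace 𝓘(ℝ, E') x),
    g.inner x u (J x v) = g.inner x (J x u) v
  contMDiff : ContMDiff 𝓘(ℝ, E') (𝓘(ℝ, E').prod 𝓘(ℝ, E' →L[ℝ] E')) ∞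
    (fun x ↦ TotalSpace.mk' (E' →L[ℝ] E') x (J x))

/-- `J` is parallel with respect to `∇`: `∇_v (J Y) = J (∇_v Y)`. -/
def MetallicStructure.IsParallel {g : SemiRiemannianMetric E' N} {p q : ℕ}
    (J : MetallicStructure g p q)
    (nabla : CovariantDerivative 𝓘(ℝ, E') E' (fun x : N ↦ TangentSpace 𝓘(ℝ, E') x)) : Prop :=
  ∀ (Y : ∀ x : N, TangentSpace 𝓘(ℝ, E') x) (x : N) (v : TangentSpace 𝓘(ℝ, E') x),
    MDiffAt (T% Y) x → nabla (fun y ↦ J.J y (Y y)) x v = J.J x (nabla Y x v)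

/-- The quarter-symmetric connection `D_U V = ∇_U V + π(V) J U`, where `π(V) = g (V, η) = g (η, V)`. -/
def quarterSymmetric {g : SemiRiemannianMetric E' N} {p q : ℕ} (J : MetallicStructure g p q)
    (nabla : CovariantDerivative 𝓘(ℝ, E') E' (fun x : N ↦ TangentSpace 𝓘(ℝ, E') x))
    (η : ∀ x : N, TangentSpace 𝓘(ℝ, E') x) :
    CovariantDerivative 𝓘(ℝ, E') E' (fun x : N ↦ TangentSpace 𝓘(ℝ, E') x) :=
  nabla.addOneForm fun x ↦ (g.inner x (η x)).smulRight (J.J x)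

end Ambient

/-! ### Submanifolds -/

section Submanifold

variable {E E' : Type*} [NormedAddCommGroup E] [NormedSpace ℝ E]
  [NormedAddCommGroup E'] [NormedSpace ℝ E']
  {M : Type*} [TopologicalSpace M] [ChartedSpace E M] [IsManifold 𝓘(ℝ, E) ∞ M]
  {N : Type*} [TopologicalSpace N] [ChartedSpace E' N] [IsManifold 𝓘(ℝ, E') ∞ N]

/-- Smoothness at `x` of a vector field `X` of `N` along the map `ι : M → N`. -/
def SmoothAlongAt (ι : M → N) (X : ∀ x : M, TangentSpace 𝓘(ℝ, E') (ι x)) (x : M) : Prop :=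
  ContMDiffAt 𝓘(ℝ, E) (𝓘(ℝ, E').prod 𝓘(ℝ, E')) ∞
    (fun y ↦ (⟨ι y, X y⟩ : TangentBundle 𝓘(ℝ, E') N)) x

/-- `D` is a smooth vector subbundle of rank `k` of the restriction of `TN` to `M`: it has local
smooth frames with `k` elements. -/
def IsSmoothSubbundle (ι : M → N) (D : ∀ x : M, Submodule ℝ (TangentSpace 𝓘(ℝ, E') (ι x)))
    (k : ℕ) : Prop :=
  ∀ x₀ : M, ∃ s : Fin k → ∀ x : M, TangentSpace 𝓘(ℝ, E') (ι x), ∀ᶠ x in 𝓝 x₀,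
    (∀ i, SmoothAlongAt (E := E) ι (s i) x) ∧ LinearIndependent ℝ (fun i ↦ s i x) ∧
      Submodule.span ℝ (Set.range fun i ↦ s i x) = D x

/-- Covariant derivative at `x`, with respect to the connection `D` of `N`, of a vector field `X`
of `N` along the map `ι : M → N` (the pull-back connection): in the trivialization of `TN` around
`ι x` with frame `(e_k)`, it is `u ↦ ∑ k, dX^k(u) e_k + ∑ k, X^k(x) D_{dι(u)} e_k`. -/
def pullbackCov (D : CovariantDerivative 𝓘(ℝ, E') E' (fun y : N ↦ TangentSpace 𝓘(ℝ, E') y))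
    (ι : M → N) (X : ∀ x : M, TangentSpace 𝓘(ℝ, E') (ι x)) (x : M) :
    TangentSpace 𝓘(ℝ, E) x →L[ℝ] TangentSpace 𝓘(ℝ, E') (ι x) :=
  let t := trivializationAt E' (fun y : N ↦ TangentSpace 𝓘(ℝ, E') y) (ι x)
  (t.symmL ℝ (ι x)).comp (mvfderiv 𝓘(ℝ, E) (fun y ↦ (t ⟨ι y, X y⟩).2) x)
    + (D (FiberBundle.extend E' (X x)) (ι x)).comp (mfderiv 𝓘(ℝ, E) 𝓘(ℝ, E') ι x)

/-- The tangent space of the submanifold at `x`, inside the tangent space of the ambient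
manifold. -/
def tangentImage (ι : M → N) (x : M) : Submodule ℝ (TangentSpace 𝓘(ℝ, E') (ι x)) :=
  LinearMap.range (mfderiv 𝓘(ℝ, E) 𝓘(ℝ, E') ι x).toLinearMap

variable (E M) in
/-- An `r`-lightlike submanifold `(M, S(TM), S(TM^⊥), ltr(TM))` of `(N, g)`, immersed by `ι`, with
radical `Rad(TM) = TM ∩ TM^⊥` of constant rank `r > 0`, a screen distribution `S(TM)` (a complement
of `Rad(TM)` in `TM`), a screen transversal bundle `S(TM^⊥)` (a complement of `Rad(TM)` in `TM^⊥`)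
and a lightlike transversal bundle `ltr(TM)` (an isotropic complement of `Rad(TM)` in the
orthogonal complement of `S(TM) ⊥ S(TM^⊥)`). -/
structure LightlikeSubmanifold (g : SemiRiemannianMetric E' N) where
  ι : M → N
  contMDiff : ContMDiff 𝓘(ℝ, E) 𝓘(ℝ, E') ∞ ι
  injective_mfderiv : ∀ x : M, Function.Injective (mfderiv 𝓘(ℝ, E) 𝓘(ℝ, E') ι x)
  r : ℕ
  r_pos : 0 < r
  screen : ∀ x : M, Submodule ℝ (TangentSpace 𝓘(ℝ, E') (ι x))
  screenTrans : ∀ x : M, Submodule ℝ (TangentSpace 𝓘(ℝ, E') (ι x))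
  ltr : ∀ x : M, Submodule ℝ (TangentSpace 𝓘(ℝ, E') (ι x))
  decomposition : ∀ x : M, IsLightlikeDecomposition (g.bilin (ι x))
    (tangentImage (E := E) ι x) (screen x) (screenTrans x) (ltr x)
  smooth_radical : IsSmoothSubbundle (E := E) ι
    (fun x ↦ tangentImage (E := E) ι x ⊓ (g.bilin (ι x)).orthogonal (tangentImage (E := E) ι x)) r
  smooth_screen : ∃ k, IsSmoothSubbundle (E := E) ι screen k
  smooth_screenTrans : ∃ k, IsSmoothSubbundle (E := E) ι screenTrans k
  smooth_ltr : ∃ k, IsSmoothSubbundle (E := E) ι ltr k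

namespace LightlikeSubmanifold

variable {g : SemiRiemannianMetric E' N} (L : LightlikeSubmanifold E M g)

/-- `TM`, as a subbundle of the restriction of `TN` to `M`. -/
def tangent (x : M) : Submodule ℝ (TangentSpace 𝓘(ℝ, E') (L.ι x)) :=
  tangentImage (E := E) L.ι x

/-- `Rad(TM) = TM ∩ TM^⊥`. -/
def radical (x : M) : Submodule ℝ (TangentSpace 𝓘(ℝ, E') (L.ι x)) :=
  L.tangent x ⊓ (g.bilin (L.ι x)).orthogonal (L.tangent x)

/-- The vector field `U` of `M`, as a vector field of `N` along `M`. -/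
def push (U : ∀ x : M, TangentSpace 𝓘(ℝ, E) x) (x : M) : TangentSpace 𝓘(ℝ, E') (L.ι x) :=
  mfderiv 𝓘(ℝ, E) 𝓘(ℝ, E') L.ι x (U x)

/-- `U ∈ Γ(B)`: `U` is a smooth vector field on `M` with values in the distribution `B`. -/
def IsSection (B : ∀ x : M, Submodule ℝ (TangentSpace 𝓘(ℝ, E') (L.ι x)))
    (U : ∀ x : M, TangentSpace 𝓘(ℝ, E) x) : Prop :=
  ContMDiff 𝓘(ℝ, E) (𝓘(ℝ, E).prod 𝓘(ℝ, E)) ∞ (fun x ↦ (⟨x, U x⟩ : TangentBundle 𝓘(ℝ, E) M)) ∧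
    ∀ x, L.push U x ∈ B x

/-- The distribution `B` is integrable: `[U, V] ∈ Γ(B)` for all `U, V ∈ Γ(B)`. -/
def IsIntegrable (B : ∀ x : M, Submodule ℝ (TangentSpace 𝓘(ℝ, E') (L.ι x))) : Prop :=
  ∀ U V : ∀ x : M, TangentSpace 𝓘(ℝ, E) x, L.IsSection B U → L.IsSection B V →
    L.IsSection B (VectorField.mlieBracket 𝓘(ℝ, E) U V)

/-- The orthogonal complement `B^⊥` of the distribution `B` in `S(TM)`. -/
def perpInScreen (B : ∀ x : M, Submodule ℝ (TangentSpace 𝓘(ℝ, E') (L.ι x))) (x : M) :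
    Submodule ℝ (TangentSpace 𝓘(ℝ, E') (L.ι x)) :=
  L.screen x ⊓ (g.bilin (L.ι x)).orthogonal (B x)

/-- `M` is screen semi-invariant with respect to `J`, with distribution `B`: the smooth distribution
`B ⊆ S(TM)` satisfies `S(TM) = B ⊥ B^⊥`, `J B = B` and `J B^⊥ ⊆ S(TM^⊥)`, and
`J Rad(TM) = Rad(TM)`. -/
structure IsScreenSemiInvariant {p q : ℕ} (J : MetallicStructure g p q)
    (B : ∀ x : M, Submodule ℝ (TangentSpace 𝓘(ℝ, E') (L.ι x))) : Prop where
  smooth : ∃ k, IsSmoothSubbundle (E := E) L.ι B k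
  le_screen : ∀ x, B x ≤ L.screen x
  disjoint : ∀ x, Disjoint (B x) (L.perpInScreen B x)
  sup_eq : ∀ x, B x ⊔ L.perpInScreen B x = L.screen x
  map_eq : ∀ x, (B x).map (J.J (L.ι x)).toLinearMap = B x
  map_perp_le : ∀ x, (L.perpInScreen B x).map (J.J (L.ι x)).toLinearMap ≤ L.screenTrans x
  map_radical : ∀ x, (L.radical x).map (J.J (L.ι x)).toLinearMap = L.radical x

variable [FiniteDimensional ℝ E']

instance (y : N) : FiniteDimensional ℝ (TangentSpace 𝓘(ℝ, E') y) :=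
  inferInstanceAs (FiniteDimensional ℝ E')

/-- The projection of `TN` on `TM` along `tr(TM) = ltr(TM) ⊥ S(TM^⊥)`. -/
def tangentProj (x : M) :
    TangentSpace 𝓘(ℝ, E') (L.ι x) →ₗ[ℝ] TangentSpace 𝓘(ℝ, E') (L.ι x) :=
  Submodule.projection _ _
    ((L.decomposition x).isCompl_tangent (g.bilin_isSymm _) (g.bilin_nondegenerate _))

/-- The projection of `TN` on `S(TM^⊥)` along `TM ⊕ ltr(TM)`. -/
def screenTransProj (x : M) :
    TangentSpace 𝓘(ℝ, E') (L.ι x) →ₗ[ℝ] TangentSpace 𝓘(ℝ, E') (L.ι x) :=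
  Submodule.projection _ _
    ((L.decomposition x).isCompl_screenTrans (g.bilin_isSymm _) (g.bilin_nondegenerate _))

/-- The projection of `TN` on `Rad(TM)` along `S(TM) ⊕ tr(TM)`; on `TM` it is the projection on
`Rad(TM)` along `S(TM)`. -/
def radicalProj (x : M) :
    TangentSpace 𝓘(ℝ, E') (L.ι x) →ₗ[ℝ] TangentSpace 𝓘(ℝ, E') (L.ι x) :=
  Submodule.projection _ _
    ((L.decomposition x).isCompl_radical (g.bilin_isSymm _) (g.bilin_nondegenerate _))

variable (D : CovariantDerivative 𝓘(ℝ, E') E' (fun y : N ↦ TangentSpace 𝓘(ℝ, E') y))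

/-- The induced connection: the tangential part of `D_U X`. -/
def inducedCov (U : ∀ x : M, TangentSpace 𝓘(ℝ, E) x)
    (X : ∀ x : M, TangentSpace 𝓘(ℝ, E') (L.ι x)) (x : M) : TangentSpace 𝓘(ℝ, E') (L.ι x) :=
  L.tangentProj x (pullbackCov D L.ι X x (U x))

/-- The screen second fundamental form `h^s(U, X)` of the connection `D`, for `X` tangent to `M`:
the component of `D_U X` in `S(TM^⊥)`. -/
def hScreen (U : ∀ x : M, TangentSpace 𝓘(ℝ, E) x)
    (X : ∀ x : M, TangentSpace 𝓘(ℝ, E') (L.ι x)) (x : M) : TangentSpace 𝓘(ℝ, E') (L.ι x) :=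
  L.screenTransProj x (pullbackCov D L.ι X x (U x))

/-- The second fundamental form `h^*(U, X)` of the screen distribution, for `X ∈ Γ(S(TM))`:
the component in `Rad(TM)` of the covariant derivative of `X` with respect to the connection
induced by `D`. -/
def hStar (U : ∀ x : M, TangentSpace 𝓘(ℝ, E) x)
    (X : ∀ x : M, TangentSpace 𝓘(ℝ, E') (L.ι x)) (x : M) : TangentSpace 𝓘(ℝ, E') (L.ι x) :=
  L.radicalProj x (L.inducedCov D U X x)

/-- The vector field `J U` along `M`, for a vector field `U` on `M`. -/
def applyJ {p q : ℕ} (J : MetallicStructure g p q) (U : ∀ x : M, TangentSpace 𝓘(ℝ, E) x) (x : M) :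
    TangentSpace 𝓘(ℝ, E') (L.ι x) :=
  J.J (L.ι x) (L.push U x)

end LightlikeSubmanifold

end Submanifold

end LightlikeGeometry

end

/-!
The proof compares `[U, V]` with the antisymmetrized covariant derivatives of `V` and `J V`. Since
the Levi-Civita connection is torsion-free and `J` is parallel, for `U, V ∈ Γ(B)` one has
`D_U V - D_V U = [U, V] + γ` and `D_U (J V) - D_V (J U) = J [U, V] + β`, where
`γ = π(V) J U - π(U) J V` and `β = π(J V) J U - π(J U) J V` are sections of `J B = B`
(`quarterSymmetric_push_sub`, `quarterSymmetric_applyJ_sub`).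

Decompose `[U, V] = r + b + c` along `TM = Rad(TM) ⊕ B ⊕ B^⊥`. As `J` preserves `Rad(TM)` and `B` and
maps `B^⊥` to `S(TM^⊥)`, the component of `J [U, V] + β` in `S(TM^⊥)` is `J c` and its tangential
component has radical part `J r`, while `[U, V] + γ` has radical part `r`. Hence the first equation
of the theorem says `J c = 0`, that is `c = 0`, and the second one says `J r = p r`. The latter
forces `r = 0`, because `J² = p J + q I` with `q > 0` excludes the eigenvalue `p`. So both together
say `[U, V] ∈ B`, at every point separately (`push_mlieBracket_mem_iff`).

The analytic part consists in the two rules for the pull-back connection along the immersion,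
`pullbackCov_torsion_free` and `pullbackCov_metallic`. They are obtained in the trivialization centred
at a point, from the identity `[U, V] f = U (V f) - V (U f)` for vector-valued functions
(`mvfderiv_mlieBracket`) and from the local formula for a connection
(`covariantDerivative_apply_eq_add_extend`).
-/

noncomputable section

namespace LightlikeGeometry

/-! ### Derivatives of vector-valued functions in charts -/

section Chart

variable {E F F' : Type*} [NormedAddCommGroup E] [NormedSpace ℝ E]
  [NormedAddCommGroup F] [NormedSpace ℝ F] [NormedAddCommGroup F'] [NormedSpace ℝ F']
  {M : Type*} [TopologicalSpace M] [ChartedSpace E M]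

theorem mvfderiv_congr {f f' : M → F} {x : M} (h : f =ᶠ[𝓝 x] f') :
    mvfderiv 𝓘(ℝ, E) f x = mvfderiv 𝓘(ℝ, E) f' x :=
  h.mfderiv_eq

/-- In the chart centred at `x`, whose own derivative at `x` is the identity, the derivative of `f`
at `x` is the Fréchet derivative of the local representative of `f`. -/
theorem mvfderiv_eq_fderiv_chart {f : M → F} {x : M} (hf : MDiffAt f x) :
    mvfderiv 𝓘(ℝ, E) f x
      = fderiv ℝ (f ∘ (extChartAt 𝓘(ℝ, E) x).symm) (extChartAt 𝓘(ℝ, E) x x) := by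
  rw [hf.mvfderiv]
  simp [writtenInExtChartAt, fderivWithin_univ]
  rfl

theorem differentiableAt_comp_chart {f : M → F} {x : M} (hf : MDiffAt f x) :
    DifferentiableAt ℝ (f ∘ (extChartAt 𝓘(ℝ, E) x).symm) (extChartAt 𝓘(ℝ, E) x x) := by
  have h := ((mdifferentiableAt_iff _ _).1 hf).2
  rwa [modelWithCornersSelf_coe, Set.range_id, differentiableWithinAt_univ] at h

theorem mvfderiv_clm_apply {A : M → F →L[ℝ] F'} {f : M → F} {x : M}
    (hA : MDiffAt A x) (hf : MDiffAt f x) (u : TangentSpace 𝓘(ℝ, E) x) :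
    mvfderiv 𝓘(ℝ, E) (fun y ↦ A y (f y)) x u
      = mvfderiv 𝓘(ℝ, E) A x u (f x) + A x (mvfderiv 𝓘(ℝ, E) f x u) := by
  rw [mvfderiv_eq_fderiv_chart (hA.clm_apply hf), mvfderiv_eq_fderiv_chart hA,
    mvfderiv_eq_fderiv_chart hf]
  have h := congrArg (fun B ↦ B u) (fderiv_clm_apply (differentiableAt_comp_chart hA)
    (differentiableAt_comp_chart hf))
  have hx := extChartAt_to_inv (I := 𝓘(ℝ, E)) x
  simp only [Function.comp_apply, hx] at h
  refine h.trans ?_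
  exact add_comm _ _

/-- The derivative of `f` along `U` is computed in a chart by the local representatives of `f` and
`U`. -/
theorem fderiv_chart_mpullbackWithin [IsManifold 𝓘(ℝ, E) ∞ M] {f : M → F} {x : M}
    (U : ∀ y : M, TangentSpace 𝓘(ℝ, E) y)
    {z : E} (hz : z ∈ (extChartAt 𝓘(ℝ, E) x).target)
    (hf : MDiffAt f ((extChartAt 𝓘(ℝ, E) x).symm z)) :
    fderiv ℝ (f ∘ (extChartAt 𝓘(ℝ, E) x).symm) z
      (VectorField.mpullbackWithin 𝓘(ℝ, E) 𝓘(ℝ, E) (extChartAt 𝓘(ℝ, E) x).symm U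
        (Set.range 𝓘(ℝ, E)) z) =
    mvfderiv 𝓘(ℝ, E) f ((extChartAt 𝓘(ℝ, E) x).symm z) (U ((extChartAt 𝓘(ℝ, E) x).symm z)) := by
  have h1 := isInvertible_mfderivWithin_extChartAt_symm (I := 𝓘(ℝ, E)) hz
  have h2 := mdifferentiableWithinAt_extChartAt_symm (I := 𝓘(ℝ, E)) hz
  have h3 := mfderiv_comp_mfderivWithin (I' := 𝓘(ℝ, E)) z hf h2
    (by simpa using uniqueMDiffWithinAt_univ 𝓘(ℝ, E))
  have h4 : fderiv ℝ (f ∘ (extChartAt 𝓘(ℝ, E) x).symm) z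
      = mfderivWithin 𝓘(ℝ, E) 𝓘(ℝ, F) (f ∘ (extChartAt 𝓘(ℝ, E) x).symm)
        (Set.range 𝓘(ℝ, E)) z := by
    rw [modelWithCornersSelf_coe, Set.range_id, mfderivWithin_univ, mfderiv_eq_fderiv]
  have h5 := congrArg (fun A ↦ A ((mfderivWithin 𝓘(ℝ, E) 𝓘(ℝ, E) (extChartAt 𝓘(ℝ, E) x).symm
    (Set.range 𝓘(ℝ, E)) z).inverse (U ((extChartAt 𝓘(ℝ, E) x).symm z)))) h3
  rw [h4]
  refine h5.trans ?_
  exact congrArg (mfderiv 𝓘(ℝ, E) 𝓘(ℝ, F) f ((extChartAt 𝓘(ℝ, E) x).symm z))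
    (h1.self_apply_inverse _)

/-- The Lie bracket acts on vector-valued functions as the commutator of derivations:
`[U, V] f = U (V f) - V (U f)`. -/
theorem mvfderiv_mlieBracket [IsManifold 𝓘(ℝ, E) ∞ M] [CompleteSpace E]
    {f : M → F} {x : M} (hf : ContMDiffAt 𝓘(ℝ, E) 𝓘(ℝ, F) ∞ f x)
    {U V : ∀ y : M, TangentSpace 𝓘(ℝ, E) y} (hU : MDiffAt (T% U) x) (hV : MDiffAt (T% V) x)
    (hfU : MDiffAt (fun y ↦ mvfderiv 𝓘(ℝ, E) f y (U y)) x)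
    (hfV : MDiffAt (fun y ↦ mvfderiv 𝓘(ℝ, E) f y (V y)) x) :
    mvfderiv 𝓘(ℝ, E) f x (VectorField.mlieBracket 𝓘(ℝ, E) U V x) =
      mvfderiv 𝓘(ℝ, E) (fun y ↦ mvfderiv 𝓘(ℝ, E) f y (V y)) x (U x)
        - mvfderiv 𝓘(ℝ, E) (fun y ↦ mvfderiv 𝓘(ℝ, E) f y (U y)) x (V x) := by
  set φ := extChartAt 𝓘(ℝ, E) x with hφ
  -- `P W` is the local representative of the vector field `W`, as a map from `E` to itself.
  let P : (∀ y : M, TangentSpace 𝓘(ℝ, E) y) → E → E := fun W ↦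
    VectorField.mpullbackWithin 𝓘(ℝ, E) 𝓘(ℝ, E) φ.symm W (Set.range 𝓘(ℝ, E))
  have hS : φ.symm ⁻¹' Set.univ ∩ Set.range 𝓘(ℝ, E) = Set.univ := by simp
  have hxx : φ.symm (φ x) = x := extChartAt_to_inv x
  have hdP : ∀ {W : ∀ y : M, TangentSpace 𝓘(ℝ, E) y}, MDiffAt (T% W) x →
      DifferentiableAt ℝ (P W) (φ x) := by
    intro W hW
    have : DifferentiableWithinAt ℝ (P W) (φ.symm ⁻¹' Set.univ ∩ Set.range 𝓘(ℝ, E)) (φ x) :=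
      (mdifferentiableWithinAt_univ.2 hW).differentiableWithinAt_mpullbackWithin_vectorField
    rwa [hS, differentiableWithinAt_univ] at this
  have hbr : VectorField.mlieBracket 𝓘(ℝ, E) U V x
      = VectorField.lieBracket ℝ (P U) (P V) (φ x) := by
    rw [← VectorField.mlieBracketWithin_univ, VectorField.mlieBracketWithin_apply]
    let A : E →L[ℝ] E := mfderiv 𝓘(ℝ, E) 𝓘(ℝ, E) φ x
    have hid : A = ContinuousLinearMap.id ℝ E := mfderiv_extChartAt_self
    change A.inverse (VectorField.lieBracketWithin ℝ
      (P U) (P V) (φ.symm ⁻¹' Set.univ ∩ Set.range 𝓘(ℝ, E)) (φ x)) = _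
    rw [hS, VectorField.lieBracketWithin_univ, hid, ContinuousLinearMap.inverse_id]
    rfl
  have hPx : ∀ W, P W (φ x) = W x := by
    intro W
    change (mfderivWithin 𝓘(ℝ, E) 𝓘(ℝ, E) φ.symm (Set.range 𝓘(ℝ, E)) (φ x) : E →L[ℝ] E).inverse
      (W (φ.symm (φ x))) = W x
    rw [hxx]
    exact mfderivWithin_extChartAt_symm_inverse_apply _
  have hfe : ∀ᶠ y in 𝓝 x, MDiffAt f y := by
    have h1 : ContMDiffAt 𝓘(ℝ, E) 𝓘(ℝ, F) 1 f x := hf.of_le (by simp)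
    filter_upwards [(contMDiffAt_iff_contMDiffAt_nhds (by simp)).1 h1] with y hy
    exact hy.mdifferentiableAt (by simp)
  have hev : ∀ᶠ z in 𝓝 (φ x), z ∈ φ.target ∧ MDiffAt f (φ.symm z) := by
    refine Filter.Eventually.and (extChartAt_target_mem_nhds x) ?_
    have hc : ContinuousAt φ.symm (φ x) := continuousAt_extChartAt_symm x
    have := hc.tendsto
    rw [hxx] at this
    exact this.eventually hfe
  have hd : ∀ {W : ∀ y : M, TangentSpace 𝓘(ℝ, E) y},
      MDiffAt (fun y ↦ mvfderiv 𝓘(ℝ, E) f y (W y)) x →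
      mvfderiv 𝓘(ℝ, E) (fun y ↦ mvfderiv 𝓘(ℝ, E) f y (W y)) x
      = fderiv ℝ (fun z ↦ fderiv ℝ (f ∘ φ.symm) z (P W z)) (φ x) := by
    intro W hW
    rw [mvfderiv_eq_fderiv_chart hW]
    refine Filter.EventuallyEq.fderiv_eq ?_
    filter_upwards [hev] with z hz
    exact (fderiv_chart_mpullbackWithin W hz.1 hz.2).symm
  have hfc : ContDiffAt ℝ 2 (f ∘ φ.symm) (φ x) := by
    have h1 := (contMDiffAt_iff.1 hf).2
    rw [modelWithCornersSelf_coe, Set.range_id, contDiffWithinAt_univ] at h1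
    exact h1.of_le ENat.LEInfty.out
  rw [hd hfU, hd hfV, mvfderiv_eq_fderiv_chart hfe.self_of_nhds, hbr]
  refine (VectorField.fderiv_apply_lieBracket hfc (by simp) (hdP hV) (hdP hU)).trans ?_
  rw [← hPx U, ← hPx V]
  rfl

end Chart

/-! ### Local formula for connections on the tangent bundle -/

section Connection

variable {E' : Type*} [NormedAddCommGroup E'] [NormedSpace ℝ E']
  {N : Type*} [TopologicalSpace N] [ChartedSpace E' N] [IsManifold 𝓘(ℝ, E') ∞ N]

/-- The coordinates of a tangent vector in the trivialization centred at `y₀` are given by the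
derivative of the chart centred at `y₀`. -/
theorem trivializationAt_snd_eq_mvfderiv {y₀ y : N} (hy : y ∈ (chartAt E' y₀).source)
    (w : TangentSpace 𝓘(ℝ, E') y) :
    (trivializationAt E' (fun y : N ↦ TangentSpace 𝓘(ℝ, E') y) y₀ ⟨y, w⟩).2
      = mvfderiv 𝓘(ℝ, E') (extChartAt 𝓘(ℝ, E') y₀) y w := by
  have hy' : y ∈ (trivializationAt E' (fun y : N ↦ TangentSpace 𝓘(ℝ, E') y) y₀).baseSet := by
    simpa using hy
  have h := TangentBundle.continuousLinearMapAt_trivializationAt (I := 𝓘(ℝ, E')) hy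
  have h1 := congrArg (fun A ↦ A w) h
  refine Eq.trans ?_ h1
  exact ((trivializationAt E' (fun y : N ↦ TangentSpace 𝓘(ℝ, E') y)
    y₀).continuousLinearMapAt_apply_of_mem (R := ℝ) hy' w).symm

variable [FiniteDimensional ℝ E']

/-- Vector fields that extend tangent vectors with constant coordinates commute. -/
theorem extend_mlieBracket (y : N) (a b : TangentSpace 𝓘(ℝ, E') y) :
    VectorField.mlieBracket 𝓘(ℝ, E') (FiberBundle.extend E' a) (FiberBundle.extend E' b) y
      = 0 := by
  set φ := extChartAt 𝓘(ℝ, E') y with hφ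
  have hconst : ∀ c : TangentSpace 𝓘(ℝ, E') y,
      (fun z ↦ mvfderiv 𝓘(ℝ, E') φ z (FiberBundle.extend E' c z)) =ᶠ[𝓝 y]
        fun _ ↦ (trivializationAt E' (fun y : N ↦ TangentSpace 𝓘(ℝ, E') y) y ⟨y, c⟩).2 := by
    intro c
    filter_upwards [(chartAt E' y).open_source.mem_nhds (mem_chart_source E' y)] with z hz
    rw [← trivializationAt_snd_eq_mvfderiv hz]
    have hz' : z ∈ (trivializationAt E' (fun y : N ↦ TangentSpace 𝓘(ℝ, E') y) y).baseSet := by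
      simpa using hz
    have h := congrArg Prod.snd ((trivializationAt E'
      (fun y : N ↦ TangentSpace 𝓘(ℝ, E') y) y).apply_mk_symm hz'
      (trivializationAt E' (fun y : N ↦ TangentSpace 𝓘(ℝ, E') y) y ⟨y, c⟩).2)
    exact h
  have hd : ∀ c : TangentSpace 𝓘(ℝ, E') y,
      MDiffAt (fun z ↦ mvfderiv 𝓘(ℝ, E') φ z (FiberBundle.extend E' c z)) y := fun c ↦
    (mdifferentiableAt_const (c := (trivializationAt E' (fun y : N ↦ TangentSpace 𝓘(ℝ, E') y) y
      ⟨y, c⟩).2)).congr_of_eventuallyEq (hconst c)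
  have h := mvfderiv_mlieBracket (f := φ) (contMDiffAt_extChartAt (n := ∞))
    (FiberBundle.mdifferentiableAt_extend 𝓘(ℝ, E') E' a)
    (FiberBundle.mdifferentiableAt_extend 𝓘(ℝ, E') E' b) (hd a) (hd b)
  rw [mvfderiv_congr (hconst a), mvfderiv_congr (hconst b), mvfderiv_const, mvfderiv_const] at h
  -- The chart is centred at `y`, so that its derivative there is the identity.
  have hid : ∀ w, mvfderiv 𝓘(ℝ, E') φ y w = w := fun w ↦
    congrArg (fun A ↦ A w) (mfderiv_extChartAt_self (I := 𝓘(ℝ, E')) (x := y))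
  rw [hid] at h
  simpa using! h

/-- Local formula for a connection: in the trivialization centred at `x`, the covariant derivative is
the derivative of the coordinates plus the derivative of the section with constant coordinates
`X x`. This determines how `pullbackCov` is related to the connection it comes from. -/
theorem covariantDerivative_apply_eq_add_extend (D : CovariantDerivative 𝓘(ℝ, E') E' (fun y : N ↦ TangentSpace 𝓘(ℝ, E') y))
    {X : ∀ y : N, TangentSpace 𝓘(ℝ, E') y} {x : N} (hX : MDiffAt (T% X) x)
    (v : TangentSpace 𝓘(ℝ, E') x) :
    D X x v = (trivializationAt E' (fun y : N ↦ TangentSpace 𝓘(ℝ, E') y) x).symmL ℝ x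
      (mvfderiv 𝓘(ℝ, E')
        (fun y ↦ (trivializationAt E' (fun y : N ↦ TangentSpace 𝓘(ℝ, E') y) x ⟨y, X y⟩).2) x v)
      + D (FiberBundle.extend E' (X x)) x v := by
  set t := trivializationAt E' (fun y : N ↦ TangentSpace 𝓘(ℝ, E') y) x with ht
  have hxt : x ∈ t.baseSet := FiberBundle.mem_baseSet_trivializationAt' x
  have hev : ∀ᶠ y in 𝓝 x, y ∈ t.baseSet := t.open_baseSet.mem_nhds hxt
  -- The difference of `D` and the coordinate derivative is tensorial, so it depends on `X x` only
  -- and may be evaluated on the section with constant coordinates.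
  have key : TensorialAt 𝓘(ℝ, E') E'
      (fun Y : ∀ y : N, TangentSpace 𝓘(ℝ, E') y ↦ D Y x v
        - t.symmL ℝ x (mvfderiv 𝓘(ℝ, E') (fun y ↦ (t ⟨y, Y y⟩).2) x v)) x := by
    constructor
    · intro f Y hf hY
      have hY' := (mdifferentiableAt_section 𝓘(ℝ, E') Y).1 hY
      have e : (fun y ↦ (t ⟨y, (f • Y) y⟩).2) =ᶠ[𝓝 x] f • fun y ↦ (t ⟨y, Y y⟩).2 := by
        filter_upwards [hev] with y hy
        exact (t.linear ℝ hy).map_smul (f y) (Y y)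
      have e2 : mvfderiv 𝓘(ℝ, E') (fun y ↦ (t ⟨y, (f • Y) y⟩).2) x
         = mvfderiv 𝓘(ℝ, E') (f • fun y ↦ (t ⟨y, Y y⟩).2) x := mvfderiv_congr e
      have e3 : t.symmL ℝ x (t ⟨x, Y x⟩).2 = Y x :=
        (t.symmL_apply hxt _).trans (t.symm_apply_apply_mk hxt (Y x))
      have e4 : t.symmL ℝ x (mvfderiv 𝓘(ℝ, E') (fun y ↦ (t ⟨y, (f • Y) y⟩).2) x v)
          = f x • t.symmL ℝ x (mvfderiv 𝓘(ℝ, E') (fun y ↦ (t ⟨y, Y y⟩).2) x v)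
            + (mvfderiv 𝓘(ℝ, E') f x v) • Y x := by
        rw [e2, mvfderiv_smul hf hY']
        change t.symmL ℝ x (f x • mvfderiv 𝓘(ℝ, E') (fun y ↦ (t ⟨y, Y y⟩).2) x v
          + (mvfderiv 𝓘(ℝ, E') f x v) • (t ⟨x, Y x⟩).2) = _
        rw [map_add, map_smul, map_smul, e3]
      rw [e4, D.isCovariantDerivativeOnUniv.leibniz hY hf]
      change f x • D Y x v + (mvfderiv 𝓘(ℝ, E') f x v) • Y x - _ = _
      module
    · intro Y Z hY hZ
      have hY' := (mdifferentiableAt_section 𝓘(ℝ, E') Y).1 hY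
      have hZ' := (mdifferentiableAt_section 𝓘(ℝ, E') Z).1 hZ
      have e2 : mvfderiv 𝓘(ℝ, E') (fun y ↦ (t ⟨y, (Y + Z) y⟩).2) x
         = mvfderiv 𝓘(ℝ, E') ((fun y ↦ (t ⟨y, Y y⟩).2) + fun y ↦ (t ⟨y, Z y⟩).2) x := by
        refine mvfderiv_congr ?_
        filter_upwards [hev] with y hy
        exact (t.linear ℝ hy).map_add (Y y) (Z y)
      rw [e2, mvfderiv_add hY' hZ', D.isCovariantDerivativeOnUniv.add hY hZ]
      simp
      abel
  have h := key.pointwise hX (FiberBundle.mdifferentiableAt_extend 𝓘(ℝ, E') E' (X x)) (by simp)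
  have e3 : mvfderiv 𝓘(ℝ, E') (fun y ↦ (t ⟨y, FiberBundle.extend E' (X x) y⟩).2) x = 0 := by
    rw [← mvfderiv_const (I := 𝓘(ℝ, E')) (t ⟨x, X x⟩).2 (x := x)]
    refine mvfderiv_congr ?_
    filter_upwards [hev] with y hy
    have h := congrArg Prod.snd (t.apply_mk_symm hy (t ⟨x, X x⟩).2)
    exact h
  simp only [e3] at h
  simp at h
  rw [← h]
  abel

end Connection

/-! ### The pull-back connection -/

section Pullback

variable {E E' : Type*} [NormedAddCommGroup E] [NormedSpace ℝ E]
  [NormedAddCommGroup E'] [NormedSpace ℝ E']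
  {M : Type*} [TopologicalSpace M] [ChartedSpace E M]
  {N : Type*} [TopologicalSpace N] [ChartedSpace E' N] [IsManifold 𝓘(ℝ, E') ∞ N]

theorem pullbackCov_apply
    (D : CovariantDerivative 𝓘(ℝ, E') E' (fun y : N ↦ TangentSpace 𝓘(ℝ, E') y))
    (ι : M → N) (X : ∀ x : M, TangentSpace 𝓘(ℝ, E') (ι x)) (x : M) (u : TangentSpace 𝓘(ℝ, E) x) :
    pullbackCov D ι X x u =
      (trivializationAt E' (fun y : N ↦ TangentSpace 𝓘(ℝ, E') y) (ι x)).symmL ℝ (ι x)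
        (mvfderiv 𝓘(ℝ, E) (fun y ↦ (trivializationAt E' (fun y : N ↦ TangentSpace 𝓘(ℝ, E') y)
          (ι x) ⟨ι y, X y⟩).2) x u)
      + D (FiberBundle.extend E' (X x)) (ι x) (mfderiv 𝓘(ℝ, E) 𝓘(ℝ, E') ι x u) := rfl

theorem pullbackCov_quarterSymmetric {g : SemiRiemannianMetric E' N} {p q : ℕ}
    (J : MetallicStructure g p q)
    (nabla : CovariantDerivative 𝓘(ℝ, E') E' (fun y : N ↦ TangentSpace 𝓘(ℝ, E') y))
    (η : ∀ y : N, TangentSpace 𝓘(ℝ, E') y) (ι : M → N)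
    (X : ∀ x : M, TangentSpace 𝓘(ℝ, E') (ι x)) (x : M) (u : TangentSpace 𝓘(ℝ, E) x) :
    pullbackCov (quarterSymmetric J nabla η) ι X x u
      = pullbackCov nabla ι X x u
        + g.inner (ι x) (η (ι x)) (X x) • J.J (ι x) (mfderiv 𝓘(ℝ, E) 𝓘(ℝ, E') ι x u) := by
  rw [pullbackCov_apply, pullbackCov_apply]
  have h : quarterSymmetric J nabla η (FiberBundle.extend E' (X x)) (ι x)
      = nabla (FiberBundle.extend E' (X x)) (ι x)
        + g.inner (ι x) (η (ι x)) (FiberBundle.extend E' (X x) (ι x)) • J.J (ι x) := rfl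
  rw [h, FiberBundle.extend_apply_self]
  simp [add_assoc]

theorem mdifferentiableAt_mfderiv_apply {ι : M → N} (hι : ContMDiff 𝓘(ℝ, E) 𝓘(ℝ, E') ∞ ι)
    [IsManifold 𝓘(ℝ, E) ∞ M] {W : ∀ x : M, TangentSpace 𝓘(ℝ, E) x} {x : M} (hW : MDiffAt (T% W) x) :
    MDifferentiableAt 𝓘(ℝ, E) (𝓘(ℝ, E').prod 𝓘(ℝ, E'))
      (fun y ↦ (⟨ι y, mfderiv 𝓘(ℝ, E) 𝓘(ℝ, E') ι y (W y)⟩ : TangentBundle 𝓘(ℝ, E') N)) x :=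
  MDifferentiableAt.comp x
    ((hι.contMDiff_tangentMap (m := ∞) le_rfl).mdifferentiable (by simp) _) hW

variable [FiniteDimensional ℝ E']

/-- The pull-back of a torsion-free connection by `ι` satisfies
`∇_U (dι V) - ∇_V (dι U) = dι [U, V]`. In coordinates `φ` of `N`, the derivatives of the coordinates
`V (φ ∘ ι)` and `U (φ ∘ ι)` give `[U, V] (φ ∘ ι)`, and the connection terms cancel because they are
symmetric on commuting extensions. -/
theorem pullbackCov_torsion_free [IsManifold 𝓘(ℝ, E) ∞ M] [CompleteSpace E]
    {g : SemiRiemannianMetric E' N}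
    {nabla : CovariantDerivative 𝓘(ℝ, E') E' (fun y : N ↦ TangentSpace 𝓘(ℝ, E') y)}
    (hnabla : IsLeviCivita g nabla) {ι : M → N} (hι : ContMDiff 𝓘(ℝ, E) 𝓘(ℝ, E') ∞ ι)
    {U V : ∀ x : M, TangentSpace 𝓘(ℝ, E) x} {x : M}
    (hU : MDiffAt (T% U) x) (hV : MDiffAt (T% V) x) :
    pullbackCov nabla ι (fun y ↦ mfderiv 𝓘(ℝ, E) 𝓘(ℝ, E') ι y (V y)) x (U x)
      - pullbackCov nabla ι (fun y ↦ mfderiv 𝓘(ℝ, E) 𝓘(ℝ, E') ι y (U y)) x (V x)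
      = mfderiv 𝓘(ℝ, E) 𝓘(ℝ, E') ι x (VectorField.mlieBracket 𝓘(ℝ, E) U V x) := by
  set t := trivializationAt E' (fun y : N ↦ TangentSpace 𝓘(ℝ, E') y) (ι x) with ht
  set φ := extChartAt 𝓘(ℝ, E') (ι x) with hφ
  have hev : ∀ᶠ y in 𝓝 x, ι y ∈ (chartAt E' (ι x)).source :=
    hι.continuous.continuousAt.eventually
      ((chartAt E' (ι x)).open_source.mem_nhds (mem_chart_source E' (ι x)))
  have hxt : ι x ∈ t.baseSet := FiberBundle.mem_baseSet_trivializationAt' _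
  have hιd : ∀ y, MDiffAt ι y := fun y ↦ hι.mdifferentiable (by simp) y
  have hcomp : ∀ y, ι y ∈ (chartAt E' (ι x)).source → ∀ w : TangentSpace 𝓘(ℝ, E) y,
      (t ⟨ι y, mfderiv 𝓘(ℝ, E) 𝓘(ℝ, E') ι y w⟩).2 = mvfderiv 𝓘(ℝ, E) (φ ∘ ι) y w := by
    intro y hy w
    rw [trivializationAt_snd_eq_mvfderiv hy]
    exact (mfderiv_comp_apply (I' := 𝓘(ℝ, E')) y (mdifferentiableAt_extChartAt hy) (hιd y) w).symm
  have hcoord : ∀ W : ∀ y : M, TangentSpace 𝓘(ℝ, E) y,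
      (fun y ↦ (t ⟨ι y, mfderiv 𝓘(ℝ, E) 𝓘(ℝ, E') ι y (W y)⟩).2)
        =ᶠ[𝓝 x] fun y ↦ mvfderiv 𝓘(ℝ, E) (φ ∘ ι) y (W y) := by
    intro W
    filter_upwards [hev] with y hy using hcomp y hy _
  have hdiff : ∀ {W : ∀ y : M, TangentSpace 𝓘(ℝ, E) y}, MDiffAt (T% W) x →
      MDiffAt (fun y ↦ mvfderiv 𝓘(ℝ, E) (φ ∘ ι) y (W y)) x := by
    intro W hW
    have h := ((mdifferentiableAt_totalSpace _ _).1 (mdifferentiableAt_mfderiv_apply hι hW)).2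
    exact h.congr_of_eventuallyEq (hcoord W).symm
  have hf : ContMDiffAt 𝓘(ℝ, E) 𝓘(ℝ, E') ∞ (φ ∘ ι) x :=
    (contMDiffAt_extChartAt (n := ∞)).comp x hι.contMDiffAt
  have hb := mvfderiv_mlieBracket hf hU hV (hdiff hU) (hdiff hV)
  have htf := hnabla.torsion_free (FiberBundle.extend E' (mfderiv 𝓘(ℝ, E) 𝓘(ℝ, E') ι x (U x)))
    (FiberBundle.extend E' (mfderiv 𝓘(ℝ, E) 𝓘(ℝ, E') ι x (V x))) (ι x)
    (FiberBundle.mdifferentiableAt_extend 𝓘(ℝ, E') E' _)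
    (FiberBundle.mdifferentiableAt_extend 𝓘(ℝ, E') E' _)
  rw [extend_mlieBracket, FiberBundle.extend_apply_self, FiberBundle.extend_apply_self,
    sub_eq_zero] at htf
  rw [pullbackCov_apply, pullbackCov_apply, htf, add_sub_add_right_eq_sub, ← map_sub,
    mvfderiv_congr (hcoord U), mvfderiv_congr (hcoord V), ← hb,
    ← hcomp x (mem_chart_source E' (ι x))]
  exact (t.symmL_apply hxt _).trans (t.symm_apply_apply_mk hxt _)

/-- A parallel `J` commutes with the pull-back connection: the derivative of the matrix of `J`, which
appears in the coordinates of `J X`, is accounted for by the covariant derivative of `J` applied to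
the constant extension of `X x`. -/
theorem pullbackCov_metallic {g : SemiRiemannianMetric E' N} {p q : ℕ} (J : MetallicStructure g p q)
    {nabla : CovariantDerivative 𝓘(ℝ, E') E' (fun y : N ↦ TangentSpace 𝓘(ℝ, E') y)}
    (hJ : J.IsParallel nabla) {ι : M → N} {x : M} (hι : MDiffAt ι x)
    {X : ∀ x : M, TangentSpace 𝓘(ℝ, E') (ι x)}
    (hX : MDifferentiableAt 𝓘(ℝ, E) (𝓘(ℝ, E').prod 𝓘(ℝ, E'))
      (fun y ↦ (⟨ι y, X y⟩ : TangentBundle 𝓘(ℝ, E') N)) x) (u : TangentSpace 𝓘(ℝ, E) x) :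
    pullbackCov nabla ι (fun y ↦ J.J (ι y) (X y)) x u = J.J (ι x) (pullbackCov nabla ι X x u) := by
  set t := trivializationAt E' (fun y : N ↦ TangentSpace 𝓘(ℝ, E') y) (ι x) with ht
  -- `A y` is the matrix of `J` in the trivialization, and `t.symmL` inverts the trivialization.
  let A : N → E' →L[ℝ] E' := fun y ↦
    (t.continuousLinearMapAt ℝ y).comp ((J.J y).comp (t.symmL ℝ y))
  have hA : MDiffAt A (ι x) := by
    have h := (mdifferentiableAt_hom_bundle _).1 (J.contMDiff.mdifferentiable (by simp) (ι x))
    exact h.2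
  have hAt : ∀ y ∈ t.baseSet, ∀ w : TangentSpace 𝓘(ℝ, E') y,
      (t ⟨y, J.J y w⟩).2 = A y (t ⟨y, w⟩).2 := by
    intro y hy w
    change _ = t.continuousLinearMapAt ℝ y (J.J y (t.symmL ℝ y (t ⟨y, w⟩).2))
    rw [t.continuousLinearMapAt_apply_of_mem (R := ℝ) hy, t.symmL_apply hy, t.symm_apply_apply_mk hy]
  have hX' : MDiffAt (fun y ↦ (t ⟨ι y, X y⟩).2) x := ((mdifferentiableAt_totalSpace _ _).1 hX).2
  have hxt : ι x ∈ t.baseSet := FiberBundle.mem_baseSet_trivializationAt' _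
  have hev : ∀ᶠ y in 𝓝 (ι x), y ∈ t.baseSet := t.open_baseSet.mem_nhds hxt
  set X₀ := (t ⟨ι x, X x⟩).2 with hX₀
  set v := mfderiv 𝓘(ℝ, E) 𝓘(ℝ, E') ι x u with hv
  have h1 : mvfderiv 𝓘(ℝ, E) (fun y ↦ (t ⟨ι y, J.J (ι y) (X y)⟩).2) x u
      = mvfderiv 𝓘(ℝ, E') A (ι x) v X₀
        + A (ι x) (mvfderiv 𝓘(ℝ, E) (fun y ↦ (t ⟨ι y, X y⟩).2) x u) := by
    have e : (fun y ↦ (t ⟨ι y, J.J (ι y) (X y)⟩).2) =ᶠ[𝓝 x]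
        fun y ↦ (A ∘ ι) y (t ⟨ι y, X y⟩).2 := by
      filter_upwards [hι.continuousAt.eventually hev] with y hy using hAt _ hy _
    rw [mvfderiv_congr e, mvfderiv_clm_apply (hA.comp x hι) hX']
    have hc : mvfderiv 𝓘(ℝ, E) (A ∘ ι) x u = mvfderiv 𝓘(ℝ, E') A (ι x) v :=
      mfderiv_comp_apply (I' := 𝓘(ℝ, E')) x hA hι u
    rw [hc]
    rfl
  have h2 : mvfderiv 𝓘(ℝ, E') (fun y ↦ (t ⟨y, J.J y (FiberBundle.extend E' (X x) y)⟩).2) (ι x) v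
      = mvfderiv 𝓘(ℝ, E') A (ι x) v X₀ := by
    have e : (fun y ↦ (t ⟨y, J.J y (FiberBundle.extend E' (X x) y)⟩).2) =ᶠ[𝓝 (ι x)]
        fun y ↦ A y X₀ := by
      filter_upwards [hev] with y hy
      have h : t ⟨y, FiberBundle.extend E' (X x) y⟩ = (y, X₀) := t.apply_mk_symm hy X₀
      rw [hAt y hy, h]
    rw [mvfderiv_congr e, mvfderiv_clm_apply hA mdifferentiableAt_const, mvfderiv_const]
    simp
  have h3 : ∀ w : E', t.symmL ℝ (ι x) (A (ι x) w) = J.J (ι x) (t.symmL ℝ (ι x) w) := by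
    intro w
    exact t.symmL_continuousLinearMapAt hxt _
  have hext := FiberBundle.mdifferentiableAt_extend 𝓘(ℝ, E') E' (X x)
  have hJext : MDiffAt (T% fun y ↦ J.J y (FiberBundle.extend E' (X x) y)) (ι x) :=
    MDifferentiableAt.clm_bundle_apply (J.contMDiff.mdifferentiable (by simp) (ι x)) hext
  have h4 := hJ _ (ι x) v hext
  rw [covariantDerivative_apply_eq_add_extend nabla hJext, h2, FiberBundle.extend_apply_self] at h4
  rw [pullbackCov_apply, pullbackCov_apply, h1, map_add, h3, map_add, ← h4]
  abel

end Pullback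

/-! ### Metallic structures and the components of a lightlike decomposition -/

section Algebra

variable {E E' : Type*} [NormedAddCommGroup E] [NormedSpace ℝ E]
  [NormedAddCommGroup E'] [NormedSpace ℝ E']
  {M : Type*} [TopologicalSpace M] [ChartedSpace E M]
  {N : Type*} [TopologicalSpace N] [ChartedSpace E' N] [IsManifold 𝓘(ℝ, E') ∞ N]
  {g : SemiRiemannianMetric E' N}

/-- `J` is injective because `J² = p J + q I` with `q ≠ 0`. -/
theorem MetallicStructure.eq_zero_of_J_eq_zero {p q : ℕ} (J : MetallicStructure g p q) {x : N}
    {v : TangentSpace 𝓘(ℝ, E') x} (h : J.J x v = 0) : v = 0 := by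
  have h1 := J.sq x v
  rw [h, map_zero, smul_zero, zero_add] at h1
  exact (smul_eq_zero.1 h1.symm).resolve_left (by exact_mod_cast J.q_pos.ne')

/-- `p` is not an eigenvalue of `J`: `J v = p v` gives `p² v = J² v = p² v + q v`. -/
theorem MetallicStructure.eq_zero_of_J_eq_smul {p q : ℕ} (J : MetallicStructure g p q) {x : N}
    {v : TangentSpace 𝓘(ℝ, E') x} (h : J.J x v = (p : ℝ) • v) : v = 0 := by
  have h1 := J.sq x v
  rw [h, map_smul, h, left_eq_add] at h1
  exact (smul_eq_zero.1 h1).resolve_left (by exact_mod_cast J.q_pos.ne')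

namespace LightlikeSubmanifold

theorem screen_le_tangent (L : LightlikeSubmanifold E M g) (x : M) : L.screen x ≤ L.tangent x :=
  (le_sup_right (a := L.radical x)).trans_eq (L.decomposition x).sup_screen

variable [FiniteDimensional ℝ E'] {L : LightlikeSubmanifold E M g} {x : M}
  {v : TangentSpace 𝓘(ℝ, E') (L.ι x)}

theorem tangentProj_of_mem_tangent (hv : v ∈ L.tangent x) : L.tangentProj x v = v :=
  Submodule.projection_apply_of_mem_left _ hv

theorem tangentProj_of_mem_screenTrans (hv : v ∈ L.screenTrans x) : L.tangentProj x v = 0 :=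
  Submodule.projection_apply_of_mem_right _ (Submodule.mem_sup_right hv)

theorem screenTransProj_of_mem_tangent (hv : v ∈ L.tangent x) : L.screenTransProj x v = 0 :=
  Submodule.projection_apply_of_mem_right _ (Submodule.mem_sup_left hv)

theorem screenTransProj_of_mem_screenTrans (hv : v ∈ L.screenTrans x) :
    L.screenTransProj x v = v :=
  Submodule.projection_apply_of_mem_left _ hv

theorem radicalProj_of_mem_radical (hv : v ∈ L.radical x) : L.radicalProj x v = v :=
  Submodule.projection_apply_of_mem_left _ hv

theorem radicalProj_of_mem_screen (hv : v ∈ L.screen x) : L.radicalProj x v = 0 :=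
  Submodule.projection_apply_of_mem_right _ (Submodule.mem_sup_left hv)

end LightlikeSubmanifold

end Algebra

/-! ### The Lie bracket of sections of `B` -/

namespace LightlikeSubmanifold

variable {E E' : Type*} [NormedAddCommGroup E] [NormedSpace ℝ E]
  [NormedAddCommGroup E'] [NormedSpace ℝ E']
  {M : Type*} [TopologicalSpace M] [ChartedSpace E M] [IsManifold 𝓘(ℝ, E) ∞ M]
  {N : Type*} [TopologicalSpace N] [ChartedSpace E' N] [IsManifold 𝓘(ℝ, E') ∞ N]
  {g : SemiRiemannianMetric E' N} {L : LightlikeSubmanifold E M g}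
  {nabla : CovariantDerivative 𝓘(ℝ, E') E' (fun y : N ↦ TangentSpace 𝓘(ℝ, E') y)}
  {p q : ℕ} {J : MetallicStructure g p q} {η : ∀ y : N, TangentSpace 𝓘(ℝ, E') y}
  {B : ∀ x : M, Submodule ℝ (TangentSpace 𝓘(ℝ, E') (L.ι x))}
  {U V : ∀ x : M, TangentSpace 𝓘(ℝ, E) x}

theorem IsSection.mdifferentiableAt (hU : L.IsSection B U) (x : M) : MDiffAt (T% U) x :=
  hU.1.mdifferentiable (by simp) x

theorem IsSection.mlieBracket [CompleteSpace E] (hU : L.IsSection B U)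
    (hV : L.IsSection B V)
    (h : ∀ x, L.push (VectorField.mlieBracket 𝓘(ℝ, E) U V) x ∈ B x) :
    L.IsSection B (VectorField.mlieBracket 𝓘(ℝ, E) U V) := by
  have : IsManifold 𝓘(ℝ, E) (minSmoothness ℝ 2) M := by
    rw [minSmoothness_of_isRCLikeNormedField]
    infer_instance
  have : IsManifold 𝓘(ℝ, E) ((⊤ : ℕ∞) + 1) M := inferInstanceAs (IsManifold 𝓘(ℝ, E) ∞ M)
  exact ⟨ContDiff.mlieBracket_vectorField (m := ⊤) (n := ⊤) hU.1 hV.1 (by simp), h⟩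

variable [FiniteDimensional ℝ E']

/-- `D_U V - D_V U = [U, V] + π(V) J U - π(U) J V`. -/
theorem quarterSymmetric_push_sub [CompleteSpace E] (hnabla : IsLeviCivita g nabla) {x : M}
    (hU : MDiffAt (T% U) x) (hV : MDiffAt (T% V) x) :
    pullbackCov (quarterSymmetric J nabla η) L.ι (L.push V) x (U x)
      - pullbackCov (quarterSymmetric J nabla η) L.ι (L.push U) x (V x)
      = L.push (VectorField.mlieBracket 𝓘(ℝ, E) U V) x
        + (g.inner (L.ι x) (η (L.ι x)) (L.push V x) • L.applyJ J U x
          - g.inner (L.ι x) (η (L.ι x)) (L.push U x) • L.applyJ J V x) := by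
  rw [pullbackCov_quarterSymmetric, pullbackCov_quarterSymmetric, add_sub_add_comm]
  exact congrArg₂ _ (pullbackCov_torsion_free hnabla L.contMDiff hU hV) rfl

/-- `D_U (J V) - D_V (J U) = J [U, V] + π(J V) J U - π(J U) J V`. -/
theorem quarterSymmetric_applyJ_sub [CompleteSpace E] (hnabla : IsLeviCivita g nabla)
    (hJ : J.IsParallel nabla) {x : M}
    (hU : MDiffAt (T% U) x) (hV : MDiffAt (T% V) x) :
    pullbackCov (quarterSymmetric J nabla η) L.ι (L.applyJ J V) x (U x)
      - pullbackCov (quarterSymmetric J nabla η) L.ι (L.applyJ J U) x (V x)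
      = J.J (L.ι x) (L.push (VectorField.mlieBracket 𝓘(ℝ, E) U V) x)
        + (g.inner (L.ι x) (η (L.ι x)) (L.applyJ J V x) • L.applyJ J U x
          - g.inner (L.ι x) (η (L.ι x)) (L.applyJ J U x) • L.applyJ J V x) := by
  have hι : MDiffAt L.ι x := L.contMDiff.mdifferentiable (by simp) x
  rw [pullbackCov_quarterSymmetric, pullbackCov_quarterSymmetric, add_sub_add_comm]
  refine congrArg₂ _ ?_ rfl
  have hpush : ∀ W : ∀ y : M, TangentSpace 𝓘(ℝ, E) y, MDiffAt (T% W) x →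
      ∀ u, pullbackCov nabla L.ι (L.applyJ J W) x u
        = J.J (L.ι x) (pullbackCov nabla L.ι (L.push W) x u) := fun W hW u ↦
    pullbackCov_metallic J hJ hι (mdifferentiableAt_mfderiv_apply L.contMDiff hW) u
  rw [hpush V hV, hpush U hU, ← map_sub]
  exact congrArg _ (pullbackCov_torsion_free hnabla L.contMDiff hU hV)

/-- The pointwise form of the result. Write `[U, V] = r + b + c` with `r` in `Rad(TM)`, `b` in `B` and
`c` in `B^⊥`. The first equation says `J c = 0`, the second one `J r = p r`. -/
theorem push_mlieBracket_mem_iff [CompleteSpace E] (hnabla : IsLeviCivita g nabla)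
    (hJ : J.IsParallel nabla) (hB : L.IsScreenSemiInvariant J B)
    (hU : L.IsSection B U) (hV : L.IsSection B V) (x : M) :
    L.push (VectorField.mlieBracket 𝓘(ℝ, E) U V) x ∈ B x ↔
      L.hScreen (quarterSymmetric J nabla η) U (L.applyJ J V) x
        = L.hScreen (quarterSymmetric J nabla η) V (L.applyJ J U) x ∧
      L.hStar (quarterSymmetric J nabla η) U (L.applyJ J V) x
          + (p : ℝ) • L.hStar (quarterSymmetric J nabla η) V (L.push U) x
        = L.hStar (quarterSymmetric J nabla η) V (L.applyJ J U) x
          + (p : ℝ) • L.hStar (quarterSymmetric J nabla η) U (L.push V) x := by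
  set w := L.push (VectorField.mlieBracket 𝓘(ℝ, E) U V) x with hw
  have hwT : w ∈ L.tangent x := ⟨_, rfl⟩
  have hBT : B x ≤ L.tangent x := (hB.le_screen x).trans (L.screen_le_tangent x)
  have hJB : ∀ {v}, v ∈ B x → J.J (L.ι x) v ∈ B x := fun hv ↦
    hB.map_eq x ▸ Submodule.mem_map_of_mem hv
  obtain ⟨r, hr, s, hs, hrs⟩ : ∃ r ∈ L.radical x, ∃ s ∈ L.screen x, r + s = w :=
    Submodule.mem_sup.1 ((L.decomposition x).sup_screen.symm ▸ hwT)
  obtain ⟨b, hb, c, hc, rfl⟩ := Submodule.mem_sup.1 ((hB.sup_eq x).symm ▸ hs)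
  have hJr : J.J (L.ι x) r ∈ L.radical x := hB.map_radical x ▸ Submodule.mem_map_of_mem hr
  have hJc : J.J (L.ι x) c ∈ L.screenTrans x := hB.map_perp_le x (Submodule.mem_map_of_mem hc)
  have hmem : w ∈ B x ↔ c = 0 ∧ r = 0 := by
    constructor
    · intro h
      have hrS : r ∈ L.screen x := by
        rw [← add_sub_cancel_right r (b + c), hrs]
        exact sub_mem (hB.le_screen x h) hs
      have hr0 : r = 0 :=
        Submodule.disjoint_def.1 (L.decomposition x).disjoint_screen r hr hrS
      have hcB : c ∈ B x := by
        rw [hr0, zero_add] at hrs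
        rw [← add_sub_cancel_left b c, hrs]
        exact sub_mem h hb
      exact ⟨Submodule.disjoint_def.1 (hB.disjoint x) c hcB hc, hr0⟩
    · rintro ⟨rfl, rfl⟩
      rwa [← hrs, zero_add, add_zero]
  -- The correction terms `β` and `γ` of the quarter-symmetric connection lie in `B`, hence they do
  -- not contribute to the components in `S(TM^⊥)` and `Rad(TM)`.
  have hUx := hU.mdifferentiableAt x
  have hVx := hV.mdifferentiableAt x
  have hJU : L.applyJ J U x ∈ B x := hJB (hU.2 x)
  have hJV : L.applyJ J V x ∈ B x := hJB (hV.2 x)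
  have e1 := quarterSymmetric_push_sub (L := L) (J := J) (η := η) hnabla hUx hVx
  have e2 := quarterSymmetric_applyJ_sub (L := L) (J := J) (η := η) hnabla hJ hUx hVx
  rw [← hw, ← hrs] at e1 e2
  set β := g.inner (L.ι x) (η (L.ι x)) (L.applyJ J V x) • L.applyJ J U x
          - g.inner (L.ι x) (η (L.ι x)) (L.applyJ J U x) • L.applyJ J V x with hβ
  set γ := g.inner (L.ι x) (η (L.ι x)) (L.push V x) • L.applyJ J U x
          - g.inner (L.ι x) (η (L.ι x)) (L.push U x) • L.applyJ J V x with hγ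
  have hβB : β ∈ B x := sub_mem (Submodule.smul_mem _ _ hJU) (Submodule.smul_mem _ _ hJV)
  have hγB : γ ∈ B x := sub_mem (Submodule.smul_mem _ _ hJU) (Submodule.smul_mem _ _ hJV)
  have hs1 : L.hScreen (quarterSymmetric J nabla η) U (L.applyJ J V) x
      - L.hScreen (quarterSymmetric J nabla η) V (L.applyJ J U) x = J.J (L.ι x) c := by
    rw [hScreen, hScreen, ← map_sub, e2]
    simp only [map_add]
    rw [screenTransProj_of_mem_tangent hJr.1, screenTransProj_of_mem_tangent (hBT (hJB hb)),
      screenTransProj_of_mem_tangent (hBT hβB), screenTransProj_of_mem_screenTrans hJc]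
    simp
  have hs2 : L.hStar (quarterSymmetric J nabla η) U (L.applyJ J V) x
      - L.hStar (quarterSymmetric J nabla η) V (L.applyJ J U) x = J.J (L.ι x) r := by
    rw [hStar, hStar, inducedCov, inducedCov, ← map_sub, ← map_sub, e2]
    simp only [map_add]
    rw [tangentProj_of_mem_tangent hJr.1, tangentProj_of_mem_tangent (hBT (hJB hb)),
      tangentProj_of_mem_tangent (hBT hβB), tangentProj_of_mem_screenTrans hJc,
      radicalProj_of_mem_radical hJr, radicalProj_of_mem_screen (hB.le_screen x (hJB hb)),
      radicalProj_of_mem_screen (hB.le_screen x hβB)]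
    simp
  have hs3 : L.hStar (quarterSymmetric J nabla η) U (L.push V) x
      - L.hStar (quarterSymmetric J nabla η) V (L.push U) x = r := by
    rw [hStar, hStar, inducedCov, inducedCov, ← map_sub, ← map_sub, e1]
    have hcS : c ∈ L.screen x := hc.1
    rw [tangentProj_of_mem_tangent (add_mem (hrs ▸ hwT) (hBT hγB)), map_add, map_add,
      radicalProj_of_mem_radical hr, radicalProj_of_mem_screen hs,
      radicalProj_of_mem_screen (hB.le_screen x hγB)]
    simp
  rw [hmem, ← sub_eq_zero (a := L.hScreen _ U _ x), hs1]
  refine and_congr ⟨fun h ↦ by rw [h, map_zero], J.eq_zero_of_J_eq_zero⟩ ?_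
  have key : J.J (L.ι x) r = (p : ℝ) • r ↔ r = 0 :=
    ⟨J.eq_zero_of_J_eq_smul, fun h ↦ by rw [h, map_zero, smul_zero]⟩
  rw [← key, ← hs2]
  nth_rw 1 [← hs3]
  rw [smul_sub, sub_eq_sub_iff_add_eq_add, add_comm ((p : ℝ) • _)]

end LightlikeSubmanifold

end LightlikeGeometry

end

theorem mainTheorem6
    {E E' : Type*} [NormedAddCommGroup E] [NormedSpace ℝ E] [FiniteDimensional ℝ E]
    [NormedAddCommGroup E'] [NormedSpace ℝ E'] [FiniteDimensional ℝ E']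
    {M : Type*} [TopologicalSpace M] [T2Space M] [SecondCountableTopology M]
    [ChartedSpace E M] [IsManifold 𝓘(ℝ, E) ∞ M]
    {N : Type*} [TopologicalSpace N] [T2Space N] [SecondCountableTopology N]
    [ChartedSpace E' N] [IsManifold 𝓘(ℝ, E') ∞ N]
    (g : LightlikeGeometry.SemiRiemannianMetric E' N)
    (nabla : CovariantDerivative 𝓘(ℝ, E') E' (fun y : N ↦ TangentSpace 𝓘(ℝ, E') y))
    (hnabla : LightlikeGeometry.IsLeviCivita g nabla)
    (p q : ℕ) (J : LightlikeGeometry.MetallicStructure g p q) (hJ : J.IsParallel nabla)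
    (η : ∀ y : N, TangentSpace 𝓘(ℝ, E') y)
    (hη : ContMDiff 𝓘(ℝ, E') (𝓘(ℝ, E').prod 𝓘(ℝ, E')) ∞
      (fun y ↦ (⟨y, η y⟩ : TangentBundle 𝓘(ℝ, E') N)))
    (D : CovariantDerivative 𝓘(ℝ, E') E' (fun y : N ↦ TangentSpace 𝓘(ℝ, E') y))
    (hD : D = LightlikeGeometry.quarterSymmetric J nabla η)
    (L : LightlikeGeometry.LightlikeSubmanifold E M g)
    (B : ∀ x : M, Submodule ℝ (TangentSpace 𝓘(ℝ, E') (L.ι x)))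
    (hB : L.IsScreenSemiInvariant J B) :
    L.IsIntegrable B ↔
      (∀ U V : (∀ x : M, TangentSpace 𝓘(ℝ, E) x), L.IsSection B U → L.IsSection B V →
        L.hScreen D U (L.applyJ J V) = L.hScreen D V (L.applyJ J U)) ∧
      (∀ U V : (∀ x : M, TangentSpace 𝓘(ℝ, E) x), L.IsSection B U → L.IsSection B V →
        L.hStar D U (L.applyJ J V) + (p : ℝ) • L.hStar D V (L.push U)
          = L.hStar D V (L.applyJ J U) + (p : ℝ) • L.hStar D U (L.push V)) := by
  subst hD
  have : CompleteSpace E := FiniteDimensional.complete ℝ E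
  constructor
  · intro h
    have h' := fun U V hU hV x ↦ (LightlikeGeometry.LightlikeSubmanifold.push_mlieBracket_mem_iff
      (η := η) hnabla hJ hB hU hV x).1 ((h U V hU hV).2 x)
    exact ⟨fun U V hU hV ↦ funext fun x ↦ (h' U V hU hV x).1,
      fun U V hU hV ↦ funext fun x ↦ (h' U V hU hV x).2⟩
  · rintro ⟨h1, h2⟩ U V hU hV
    refine hU.mlieBracket hV fun x ↦ ?_
    exact (LightlikeGeometry.LightlikeSubmanifold.push_mlieBracket_mem_iff
      hnabla hJ hB hU hV x).2 ⟨congrFun (h1 U V hU hV) x, congrFun (h2 U V hU hV) x⟩
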